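/- A circuit is a finite sequence of arbitrary one- and two-qubit unitary gates, and its cost is its number of gates. Circuits may use clean ancilla qubits (initially $|0\rangle$). There is a universal constant $K>0$ such that the following holds. Let $\hat H$ be a Hermitian matrix on $N$ qubits with eigenvalues $\lambda_0\le\lambda_1\le\dots$ (with multiplicity) and spectral gap $\Delta=\Delta(\hat H)=\lambda_1-\lambda_0>0$, and let $|\phi_0\rangle$ be its normalized ground state. Let $\delta\ge 0$ and let $C_{\hat H}(t)$ be a cost for simulating $\hat H$ up to time $t$: for all $0\le s\le t$ there is a circuit with at most $C_{\hat H}(t)$ gates that implements $e^{-i\hat Hs}$ with operator-norm error at most $\delta$, returning its ancillas to $|0\rangle$ up to this error ($\delta=0$ is exact simulation). Let $|\phi\rangle$ be an $N$-qubit state that some circuit with at most $C_0$ gates prepares exactly from $|0\cdots0\rangle$, returning its ancillas to $|0\rangle$. Then for every $0<\eta\le 1$ there is a quantum algorithm (a circuit applied to $|0\cdots 0\rangle$, followed by a measurement of its ancilla qubits, which succeeds if and only if all outcomes are $0$, and then outputs the pure state of the other $N$ qubits) such that 1. its cost is at most $K\log(2/\eta)\,\bigl(C_{\hat H}(1/\Delta)+C_0\bigr)$;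 2. it succeeds and outputs $|\phi_0\rangle$ with probability at least $|\langle\phi|\phi_0\rangle|^2-K\log(2/\eta)\,\delta$, in the sense that $P\cdot F\ge|\langle\phi|\phi_0\rangle|^2-K\log(2/\eta)\,\delta$, where $P$ is the probability of success and $F$ the fidelity with $|\phi_0\rangle$ of the state that is output on success; 3. it wrongly succeeds with probability at most $\eta+K\log(2/\eta)\,\delta$, in the sense that $P\cdot(1-F)\le\eta+K\log(2/\eta)\,\delta$. In particular, for exact simulation ($\delta=0$) the probability in 2 is at least $|\langle\phi|\phi_0\rangle|^2$, and if $\phi$ is not orthogonal to $\phi_0$ the state output on success has infidelity $1-F\le\eta/|\langle\phi|\phi_0\rangle|^2$. With $\eta=N^{-p}$ ($p$ fixed, $N\ge 2$) the cost is $O\bigl(\log N\cdot(C_{\hat H}(1/\Delta)+C_0)\bigr)=\widetilde O\bigl(C_{\hat H}(1/\Delta(\hat H))+C_0\bigr)$, where $\widetilde O$ hides a factor logarithmic in the number of qubits. -/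

import Mathlib

namespace QuantumCircuit

/-- Pure state vectors of a register of qubits labelled by `ι`: complex amplitudes on the
computational basis `ι → Bool`, with the `ℓ²` norm and inner product. -/
abbrev QState (ι : Type) [Fintype ι] : Type := EuclideanSpace ℂ (ι → Bool)

/-- The linear action of a matrix on state vectors. -/
noncomputable def act {ι : Type} [Fintype ι] [DecidableEq ι]
    (A : Matrix (ι → Bool) (ι → Bool) ℂ) (ψ : QState ι) : QState ι :=
  WithLp.toLp 2 (A.mulVec (fun b => ψ b))

/-- The computational basis state `|0…0⟩`. -/
noncomputable def zeroState (ι : Type) [Fintype ι] [DecidableEq ι] : QState ι :=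
  EuclideanSpace.single (fun _ => false) 1

/-- Elementary gates: arbitrary unitaries on one qubit or on two distinct qubits. -/
inductive Gate (ι : Type) : Type
  | one (p : ι) (G : Matrix.unitaryGroup Bool ℂ) : Gate ι
  | two (p q : ι) (hpq : p ≠ q) (G : Matrix.unitaryGroup (Bool × Bool) ℂ) : Gate ι

/-- The matrix of a gate on the whole register: the gate on its own qubit(s), the identity on
all the others. -/
def Gate.toMatrix {ι : Type} [Fintype ι] [DecidableEq ι] :
    Gate ι → Matrix (ι → Bool) (ι → Bool) ℂ
  | .one p G => Matrix.of fun x y =>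
      if ∀ k, k ≠ p → x k = y k then (G : Matrix Bool Bool ℂ) (x p) (y p) else 0
  | .two p q _ G => Matrix.of fun x y =>
      if ∀ k, k ≠ p → k ≠ q → x k = y k then
        (G : Matrix (Bool × Bool) (Bool × Bool) ℂ) (x p, x q) (y p, y q) else 0

/-- A circuit is a finite sequence of elementary gates, the head being applied first. Its cost is
the number of its gates, that is, the length of the list. -/
abbrev Circuit (ι : Type) : Type := List (Gate ι)

/-- The unitary matrix that a circuit implements. -/
noncomputable def Circuit.toMatrix {ι : Type} [Fintype ι] [DecidableEq ι] :
    Circuit ι → Matrix (ι → Bool) (ι → Bool) ℂ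
  | [] => 1
  | g :: c => Circuit.toMatrix c * g.toMatrix

/-- The state `|ψ⟩ ⊗ |0^a⟩`: an `N`-qubit state together with `a` ancilla qubits in state `0`. -/
noncomputable def withAncillas {N : ℕ} (a : ℕ) (ψ : QState (Fin N)) : QState (Fin N ⊕ Fin a) :=
  WithLp.toLp 2 fun b =>
    if ∀ j : Fin a, b (Sum.inr j) = false then ψ (fun i => b (Sum.inl i)) else 0

/-- `e^{-iHs}`, the evolution for time `s` under the Hamiltonian `H`. -/
noncomputable def evolution {N : ℕ} (H : Matrix (Fin N → Bool) (Fin N → Bool) ℂ) (s : ℝ) :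
    Matrix (Fin N → Bool) (Fin N → Bool) ℂ :=
  NormedSpace.exp ((-(Complex.I * (s : ℂ))) • H)

/-- The circuit `c`, which may use `a` ancilla qubits that start in `0` and have to be returned
to `0`, simulates `H` for time `s` with error at most `δ` (in operator norm). -/
def Simulates {N a : ℕ} (c : Circuit (Fin N ⊕ Fin a))
    (H : Matrix (Fin N → Bool) (Fin N → Bool) ℂ) (s δ : ℝ) : Prop :=
  ∀ ψ : QState (Fin N),
    ‖act (Circuit.toMatrix c) (withAncillas a ψ) - withAncillas a (act (evolution H s) ψ)‖
      ≤ δ * ‖ψ‖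

/-- `C t` is a cost for simulating `H` up to time `t` (with error `δ`): for every `t ≥ 0`, each of
the evolutions `e^{-iHs}` with `0 ≤ s ≤ t` is simulated by a circuit with at most `C t` gates. -/
def IsSimulationCost {N : ℕ} (H : Matrix (Fin N → Bool) (Fin N → Bool) ℂ) (δ : ℝ)
    (C : ℝ → ℝ) : Prop :=
  ∀ t : ℝ, 0 ≤ t → ∀ s : ℝ, 0 ≤ s → s ≤ t →
    ∃ (a : ℕ) (c : Circuit (Fin N ⊕ Fin a)), (c.length : ℝ) ≤ C t ∧ Simulates c H s δ

/-- The state `φ` can be prepared from `|0…0⟩` by a circuit with at most `C₀` gates, possibly with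
ancilla qubits that start in `0` and are returned to `0`. -/
def PreparableWithCost {N : ℕ} (φ : QState (Fin N)) (C₀ : ℝ) : Prop :=
  ∃ (a : ℕ) (c : Circuit (Fin N ⊕ Fin a)), (c.length : ℝ) ≤ C₀ ∧
    act (Circuit.toMatrix c) (zeroState (Fin N ⊕ Fin a)) = withAncillas a φ

/-- `Δ` is the spectral gap `λ₁ - λ₀` of the Hermitian matrix `H`, where `λ₀ ≤ λ₁ ≤ …` are its
eigenvalues counted with multiplicity. -/
def IsSpectralGap {N : ℕ} {H : Matrix (Fin N → Bool) (Fin N → Bool) ℂ} (hH : H.IsHermitian)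
    (Δ : ℝ) : Prop :=
  ∃ i₀, (∀ j, hH.eigenvalues i₀ ≤ hH.eigenvalues j) ∧
    IsLeast {d : ℝ | ∃ j, j ≠ i₀ ∧ d = hH.eigenvalues j - hH.eigenvalues i₀} Δ

/-- `φ₀` is a ground state: a unit eigenvector for the least eigenvalue. -/
def IsGroundState {N : ℕ} {H : Matrix (Fin N → Bool) (Fin N → Bool) ℂ} (hH : H.IsHermitian)
    (φ₀ : QState (Fin N)) : Prop :=
  ‖φ₀‖ = 1 ∧ ∃ i₀, (∀ j, hH.eigenvalues i₀ ≤ hH.eigenvalues j) ∧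
    act H φ₀ = (hH.eigenvalues i₀ : ℂ) • φ₀

/-- The quantum algorithm given by the circuit `c` on `N` output qubits and `m` ancilla qubits:
start in `|0…0⟩`, apply `c`, measure all the ancillas, and succeed if and only if every outcome
is `0`. This is the unnormalized state of the output register on success: its squared norm is the
probability of success, and normalized it is the state that is output on success. -/
noncomputable def successOutput {N m : ℕ} (c : Circuit (Fin N ⊕ Fin m)) : QState (Fin N) :=
  WithLp.toLp 2 fun x =>
    act (Circuit.toMatrix c) (zeroState (Fin N ⊕ Fin m)) (Sum.elim x (fun _ => false))

/-- Probability of success. -/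
noncomputable def successProb {N m : ℕ} (c : Circuit (Fin N ⊕ Fin m)) : ℝ :=
  ‖successOutput c‖ ^ 2

/-- Probability that the algorithm succeeds and its output state is found to be `φ₀`, that is,
the probability of success times the fidelity of the normalized output state with `φ₀`. -/
noncomputable def outputProb {N m : ℕ} (c : Circuit (Fin N ⊕ Fin m)) (φ₀ : QState (Fin N)) : ℝ :=
  ‖inner ℂ φ₀ (successOutput c)‖ ^ 2

end QuantumCircuit

/-! Write E for the least eigenvalue. A Hadamard test on `e^{-iHs}`, with the phase `e^{iEs}`
inserted and the ancillas found in 0, multiplies the unnormalized output by `(1 + e^{-i(H-E)s})/2`.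
This fixes the ground component and multiplies the weight of an eigenvector with excitation energy ω
by `(1 + cos(ωs))/2`. No single s is good for every ω ≥ Δ, but the average of this factor over s in
`[0, 1/Δ]` is at most 19/20. Hence for each given vector some s shrinks its total excited weight by
19/20 (`weightOff_cosFilter_le`). The times may depend on the vector because only the existence of a
circuit is claimed.

Iterating r = O(log(2/η)) times, with fresh ancillas in each round and all measurements left to the
end, brings the excited weight, which is P(1 - F), below η. The ground amplitude is unchanged
(`exists_filtered_output`). The filter is a contraction, so the simulation errors only add up to rδ
in norm, which costs at most 2rδ in either probability.

For the cost, diagonalizing each gate gives a controlled version with at most 7 gates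
(`Gate.exists_isControlled`), so a round takes at most `7 * c.length + 2` gates. The additive 2 is
absorbed if the simulation cost is at least 1. Otherwise the empty circuit simulates H, which forces
δ ≥ 2/9 (`Simulates.le_of_nil`) and makes the probability bounds trivial. -/

set_option linter.unusedSectionVars false

namespace QuantumCircuit

open Function

/-! ### Circuits acting on amplitudes, unitarity, and embedding into larger registers. -/

section Semantics

variable {ι κ : Type} [Fintype ι] [DecidableEq ι] [Fintype κ] [DecidableEq κ]

/-- The action of a gate on amplitude functions. -/
noncomputable def Gate.apply : Gate ι → ((ι → Bool) → ℂ) → (ι → Bool) → ℂ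
  | .one p G => fun ψ x => ∑ b, (G : Matrix Bool Bool ℂ) (x p) b * ψ (update x p b)
  | .two p q _ G => fun ψ x =>
      ∑ b : Bool × Bool, (G : Matrix (Bool × Bool) (Bool × Bool) ℂ) (x p, x q) b *
        ψ (update (update x p b.1) q b.2)

/-- In row x only the configurations agreeing with x off the gate's qubits contribute, and `update`
parametrizes them injectively. -/
theorem Gate.toMatrix_mulVec (g : Gate ι) (ψ : (ι → Bool) → ℂ) :
    g.toMatrix.mulVec ψ = g.apply ψ := by
  cases g with
  | one p G =>
    funext x
    simp only [Matrix.mulVec, dotProduct, Gate.toMatrix, Gate.apply, Matrix.of_apply]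
    symm
    refine Finset.sum_of_injOn (fun b => update x p b) ?_ (by simp) ?_ ?_
    · exact (update_injective x p).injOn
    · intro y _ hy
      rw [if_neg, zero_mul]
      intro h
      refine hy ⟨y p, by simp, ?_⟩
      funext k
      by_cases hk : k = p
      · subst hk; simp
      · simp [hk, h k hk]
    · intro b _
      rw [if_pos, update_self]
      intro k hk
      simp [hk]
  | two p q hpq G =>
    funext x
    simp only [Matrix.mulVec, dotProduct, Gate.toMatrix, Gate.apply, Matrix.of_apply]
    symm
    refine Finset.sum_of_injOn (fun b : Bool × Bool => update (update x p b.1) q b.2) ?_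
      (by simp) ?_ ?_
    · intro b _ b' _ h
      have h1 := congrFun h p
      have h2 := congrFun h q
      simp [hpq] at h1 h2
      exact Prod.ext h1 h2
    · intro y _ hy
      rw [if_neg, zero_mul]
      intro h
      refine hy ⟨(y p, y q), by simp, ?_⟩
      funext k
      by_cases hk : k = q
      · subst hk; simp
      · by_cases hk' : k = p
        · subst hk'; simp [hk]
        · simp [hk, hk', h k hk' hk]
    · intro b _
      rw [if_pos]
      · simp [hpq]
      · intro k hk hk'
        simp [hk, hk']

theorem Gate.apply_one_mul (p : ι) (A B : Matrix.unitaryGroup Bool ℂ) (ψ : (ι → Bool) → ℂ) :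
    (Gate.one p (A * B)).apply ψ = (Gate.one p A).apply ((Gate.one p B).apply ψ) := by
  funext x
  simp only [Gate.apply, update_self, update_idem, Submonoid.coe_mul, Matrix.mul_apply,
    Finset.sum_mul, Finset.mul_sum, mul_assoc]
  exact Finset.sum_comm

theorem Gate.apply_one_one (p : ι) (ψ : (ι → Bool) → ℂ) : (Gate.one p 1).apply ψ = ψ := by
  funext x
  simp [Gate.apply, Matrix.one_apply]

theorem update_update_update_update {α : Type} (x : ι → α) {p q : ι} (hpq : p ≠ q)
    (a b c d : α) :
    update (update (update (update x p a) q b) p c) q d = update (update x p c) q d := by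
  rw [update_comm hpq.symm, update_idem, update_idem]

theorem Gate.apply_two_mul (p q : ι) (hpq : p ≠ q)
    (A B : Matrix.unitaryGroup (Bool × Bool) ℂ) (ψ : (ι → Bool) → ℂ) :
    (Gate.two p q hpq (A * B)).apply ψ =
      (Gate.two p q hpq A).apply ((Gate.two p q hpq B).apply ψ) := by
  funext x
  simp only [Gate.apply, update_self, update_of_ne hpq, update_update_update_update x hpq,
    Submonoid.coe_mul, Matrix.mul_apply, Finset.sum_mul, Finset.mul_sum, mul_assoc]
  exact Finset.sum_comm

theorem Gate.apply_two_one (p q : ι) (hpq : p ≠ q) (ψ : (ι → Bool) → ℂ) :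
    (Gate.two p q hpq 1).apply ψ = ψ := by
  funext x
  simp [Gate.apply, Matrix.one_apply]

/-- The inverse gate. -/
def Gate.inv : Gate ι → Gate ι
  | .one p G => .one p (star G)
  | .two p q h G => .two p q h (star G)

theorem Gate.inv_apply_apply (g : Gate ι) (ψ : (ι → Bool) → ℂ) :
    g.inv.apply (g.apply ψ) = ψ := by
  cases g with
  | one p G => rw [Gate.inv, ← Gate.apply_one_mul, Unitary.star_mul_self, Gate.apply_one_one]
  | two p q h G => rw [Gate.inv, ← Gate.apply_two_mul, Unitary.star_mul_self, Gate.apply_two_one]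

theorem Gate.toMatrix_inv (g : Gate ι) : g.inv.toMatrix = star g.toMatrix := by
  cases g with
  | one p G =>
    ext x y
    simp only [Gate.inv, Gate.toMatrix, Matrix.of_apply, Matrix.star_apply, Unitary.coe_star]
    simp only [eq_comm (a := y _)]
    split_ifs <;> simp
  | two p q h G =>
    ext x y
    simp only [Gate.inv, Gate.toMatrix, Matrix.of_apply, Matrix.star_apply, Unitary.coe_star]
    simp only [eq_comm (a := y _)]
    split_ifs <;> simp

theorem Gate.toMatrix_mem_unitaryGroup (g : Gate ι) :
    g.toMatrix ∈ Matrix.unitaryGroup (ι → Bool) ℂ := by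
  rw [Matrix.mem_unitaryGroup_iff', ← Gate.toMatrix_inv]
  apply Matrix.toLin'.injective
  refine LinearMap.ext fun ψ => ?_
  rw [Matrix.toLin'_apply, ← Matrix.mulVec_mulVec, Gate.toMatrix_mulVec, Gate.toMatrix_mulVec,
    Gate.inv_apply_apply, Matrix.toLin'_one, LinearMap.id_apply]

theorem Circuit.toMatrix_mem_unitaryGroup (c : Circuit ι) :
    Circuit.toMatrix c ∈ Matrix.unitaryGroup (ι → Bool) ℂ := by
  induction c with
  | nil => exact one_mem _
  | cons g c ih => exact mul_mem ih g.toMatrix_mem_unitaryGroup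

theorem norm_act_of_mem_unitaryGroup {A : Matrix (ι → Bool) (ι → Bool) ℂ}
    (hA : A ∈ Matrix.unitaryGroup (ι → Bool) ℂ) (ψ : QState ι) : ‖act A ψ‖ = ‖ψ‖ := by
  have h : inner ℂ (act A ψ) (act A ψ) = inner ℂ ψ ψ := by
    simp only [EuclideanSpace.inner_eq_star_dotProduct, act]
    rw [Matrix.star_mulVec, dotProduct_comm, ← Matrix.dotProduct_mulVec, Matrix.mulVec_mulVec,
      ← Matrix.star_eq_conjTranspose, Matrix.mem_unitaryGroup_iff'.1 hA, Matrix.one_mulVec,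
      dotProduct_comm]
  rw [inner_self_eq_norm_sq_to_K, inner_self_eq_norm_sq_to_K] at h
  have h' : ‖act A ψ‖ ^ 2 = ‖ψ‖ ^ 2 := by exact_mod_cast h
  exact (sq_eq_sq₀ (norm_nonneg _) (norm_nonneg _)).1 h'

/-- The action of a circuit on amplitude functions. -/
noncomputable def Circuit.run (c : Circuit ι) (ψ : (ι → Bool) → ℂ) : (ι → Bool) → ℂ :=
  (Circuit.toMatrix c).mulVec ψ

theorem Circuit.run_nil (ψ : (ι → Bool) → ℂ) : Circuit.run [] ψ = ψ := by
  simp [Circuit.run, Circuit.toMatrix]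

theorem Circuit.run_cons (g : Gate ι) (c : Circuit ι) (ψ : (ι → Bool) → ℂ) :
    Circuit.run (g :: c) ψ = Circuit.run c (g.apply ψ) := by
  simp [Circuit.run, Circuit.toMatrix, ← Matrix.mulVec_mulVec, Gate.toMatrix_mulVec]

theorem Circuit.run_append (c c' : Circuit ι) (ψ : (ι → Bool) → ℂ) :
    Circuit.run (c ++ c') ψ = Circuit.run c' (Circuit.run c ψ) := by
  induction c generalizing ψ with
  | nil => simp [Circuit.run_nil]
  | cons g c ih => simp [Circuit.run_cons, ih]

theorem Circuit.run_smul (c : Circuit ι) (a : ℂ) (ψ : (ι → Bool) → ℂ) :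
    Circuit.run c (a • ψ) = a • Circuit.run c ψ :=
  Matrix.mulVec_smul _ _ _

theorem Circuit.run_zero (c : Circuit ι) :
    Circuit.run c 0 = 0 :=
  Matrix.mulVec_zero _

/-- Relabelling of the qubits of a gate. -/
def Gate.map (f : ι ↪ κ) : Gate ι → Gate κ
  | .one p G => .one (f p) G
  | .two p q h G => .two (f p) (f q) (f.injective.ne h) G

/-- The configurations `w y` of a larger register carry `y` along `f` and are constant elsewhere. -/
def IsSlice (f : ι ↪ κ) (w : (ι → Bool) → κ → Bool) : Prop :=
  ∀ y p b, w (update y p b) = update (w y) (f p) b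

theorem IsSlice.apply_eq {f : ι ↪ κ} {w : (ι → Bool) → κ → Bool} (hw : IsSlice f w)
    (y : ι → Bool) (i : ι) : w y (f i) = y i := by
  have := congrFun (hw y i (y i)) (f i)
  simpa using this

/-- A relabelled gate changes only qubits in the image of f, so it never leaves the slice; the
remaining qubits are mere parameters. -/
theorem IsSlice.apply_map {f : ι ↪ κ} {w : (ι → Bool) → κ → Bool} (hw : IsSlice f w)
    (g : Gate ι) (Ψ : (κ → Bool) → ℂ) :
    (g.map f).apply Ψ ∘ w = g.apply (Ψ ∘ w) := by
  funext y
  cases g <;> simp [Gate.map, Gate.apply, hw.apply_eq, hw _ _ _]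

theorem IsSlice.run_map {f : ι ↪ κ} {w : (ι → Bool) → κ → Bool} (hw : IsSlice f w)
    (c : Circuit ι) (Ψ : (κ → Bool) → ℂ) :
    Circuit.run (c.map (Gate.map f)) Ψ ∘ w = Circuit.run c (Ψ ∘ w) := by
  induction c generalizing Ψ with
  | nil => simp [Circuit.run_nil]
  | cons g c ih => rw [List.map_cons, Circuit.run_cons, Circuit.run_cons, ih, hw.apply_map]

end Semantics

/-! ### Diagonalization of gates and controlled circuits. -/

section Control

/-- Diagonal gates. -/
noncomputable def phases {n : Type} [Fintype n] [DecidableEq n] (d : n → Circle) :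
    Matrix.unitaryGroup n ℂ :=
  ⟨Matrix.diagonal fun i => (d i : ℂ), by
    rw [Matrix.mem_unitaryGroup_iff, Matrix.star_eq_conjTranspose, Matrix.diagonal_conjTranspose,
      Matrix.diagonal_mul_diagonal, ← Matrix.diagonal_one]
    congr 1
    funext i
    simp only [Pi.star_apply, RCLike.star_def, Complex.mul_conj, Complex.normSq_eq_norm_sq,
      Circle.norm_coe, one_pow, Complex.ofReal_one]⟩

/-- The controlled-not gate. -/
noncomputable def cnot : Matrix.unitaryGroup (Bool × Bool) ℂ :=
  ⟨Matrix.of fun x y => if y = (x.1, xor x.1 x.2) then 1 else 0, by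
    rw [Matrix.mem_unitaryGroup_iff]
    ext ⟨a, b⟩ ⟨c, d⟩
    cases a <;> cases b <;> cases c <;> cases d <;>
      simp [Matrix.mul_apply]⟩

open scoped Matrix.Norms.L2Operator in
/-- Every unitary matrix is the exponential of `i` times a Hermitian matrix. -/
theorem exists_isHermitian_exp_eq {n : Type} [Fintype n] [DecidableEq n]
    (U : Matrix.unitaryGroup n ℂ) :
    ∃ A : Matrix n n ℂ, A.IsHermitian ∧ NormedSpace.exp (Complex.I • A) = U := by
  -- On a finite spectrum every function is continuous, so the functional calculus applies to
  -- `Complex.arg` despite its branch cut.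
  have hfin : (spectrum ℂ (U : Matrix n n ℂ)).Finite := Matrix.finite_spectrum _
  have hU : IsStarNormal (U : Matrix n n ℂ) := ⟨by
    rw [commute_iff_eq, Matrix.mem_unitaryGroup_iff.1 U.2, Matrix.mem_unitaryGroup_iff'.1 U.2]⟩
  have hc (f : ℂ → ℂ) : ContinuousOn f (spectrum ℂ (U : Matrix n n ℂ)) := hfin.continuousOn f
  refine ⟨cfc (fun z : ℂ => (z.arg : ℂ)) (U : Matrix n n ℂ), ?_, ?_⟩
  · rw [Matrix.IsHermitian, ← Matrix.star_eq_conjTranspose, ← cfc_star]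
    simp
  · rw [← cfc_const_mul Complex.I _ _ (hc _), ← CFC.exp_eq_normedSpace_exp (𝕜 := ℂ),
      ← cfc_comp' _ _ _ (hfin.image _ |>.continuousOn _) (hc _)]
    conv_rhs => rw [← cfc_id' ℂ (U : Matrix n n ℂ)]
    refine cfc_congr fun z hz => ?_
    have hz1 : ‖z‖ = 1 := by
      simpa using spectrum.norm_eq_one_of_unitary U.2 hz
    rw [← Complex.exp_eq_exp_ℂ]
    simpa [hz1, mul_comm] using Complex.norm_mul_exp_arg_mul_I z

/-- Unitary matrices are unitarily diagonalizable. -/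
theorem exists_eq_mul_phases_mul_star {n : Type} [Fintype n] [DecidableEq n]
    (U : Matrix.unitaryGroup n ℂ) :
    ∃ (V : Matrix.unitaryGroup n ℂ) (d : n → Circle), U = V * phases d * star V := by
  obtain ⟨A, hA, hAU⟩ := exists_isHermitian_exp_eq U
  refine ⟨hA.eigenvectorUnitary, fun i => Circle.exp (hA.eigenvalues i), Subtype.ext ?_⟩
  have hu : IsUnit (hA.eigenvectorUnitary : Matrix n n ℂ) :=
    (Unitary.toUnits hA.eigenvectorUnitary).isUnit
  have hinv : (hA.eigenvectorUnitary : Matrix n n ℂ)⁻¹ =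
      star (hA.eigenvectorUnitary : Matrix n n ℂ) :=
    Matrix.inv_eq_left_inv (Unitary.coe_star_mul_self _)
  rw [← hAU]
  conv_lhs => rw [hA.spectral_theorem, Unitary.conjStarAlgAut_apply, ← hinv, ← Matrix.smul_mul,
    ← Matrix.mul_smul, Matrix.exp_conj _ _ hu, ← Matrix.diagonal_smul, Matrix.exp_diagonal, hinv]
  simp only [Submonoid.coe_mul, Unitary.coe_star, phases]
  congr 3
  funext i
  rw [Pi.coe_exp, ← Complex.exp_eq_exp_ℂ]
  simp [Circle.coe_exp, mul_comm]

variable {ι : Type} [Fintype ι] [DecidableEq ι]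

theorem Gate.apply_phases (p q : ι) (hpq : p ≠ q) (d : Bool × Bool → Circle)
    (ψ : (ι → Bool) → ℂ) (x : ι → Bool) :
    (Gate.two p q hpq (phases d)).apply ψ x = d (x p, x q) * ψ x := by
  simp [Gate.apply, phases, Matrix.diagonal_apply]

theorem Gate.apply_phases_one (p : ι) (d : Bool → Circle)
    (ψ : (ι → Bool) → ℂ) (x : ι → Bool) :
    (Gate.one p (phases d)).apply ψ x = d (x p) * ψ x := by
  simp [Gate.apply, phases, Matrix.diagonal_apply]

theorem Gate.apply_cnot (p q : ι) (hpq : p ≠ q)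
    (ψ : (ι → Bool) → ℂ) (x : ι → Bool) :
    (Gate.two p q hpq cnot).apply ψ x = ψ (update x q (xor (x p) (x q))) := by
  simp [Gate.apply, cnot]

/-- The configuration with the control qubit in state `b`. -/
def withControl (b : Bool) (y : ι → Bool) : Option ι → Bool := fun o => o.elim b y

theorem isSlice_withControl (b : Bool) : IsSlice Embedding.some (withControl (ι := ι) b) := by
  intro y p v
  funext o
  cases o with
  | none => simp [withControl]
  | some i => by_cases h : i = p <;> simp [withControl, h]

/-- `c'` is a controlled version of `c`. -/
def IsControlled (c' : Circuit (Option ι)) (c : Circuit ι) : Prop :=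
  ∀ Ψ, Circuit.run c' Ψ ∘ withControl false = Ψ ∘ withControl false ∧
    Circuit.run c' Ψ ∘ withControl true = Circuit.run c (Ψ ∘ withControl true)

/-- Phases depending on x, y and their parity suffice to write any two-qubit diagonal. Matching the
four values reduces to extracting a square root c in the circle, obtained by halving an angle. -/
theorem exists_circle_factorization (g : Bool × Bool → Circle) :
    ∃ α β γ : Bool → Circle, ∀ x y, α x * β y * γ (xor x y) = g (x, y) := by
  obtain ⟨c, hc⟩ : ∃ c : Circle,
      c * c = g (true, false) * g (false, true) * g (false, false) / g (true, true) := by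
    obtain ⟨t, ht⟩ : ∃ t : ℝ, Circle.exp t =
      g (true, false) * g (false, true) * g (false, false) / g (true, true) := ⟨_, Circle.exp_arg _⟩
    exact ⟨Circle.exp (t / 2), by rw [← Circle.exp_add, add_halves, ht]⟩
  refine ⟨fun x => if x then g (true, false) / c else 1,
    fun x => if x then g (false, true) / c else 1,
    fun x => if x then c else g (false, false), ?_⟩
  have h : g (true, false) / c * (g (false, true) / c) * g (false, false) = g (true, true) := by
    rw [div_mul_div_comm, hc, div_mul_eq_mul_div, div_eq_iff_eq_mul]
    exact (mul_div_cancel _ _).symm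
  rintro (_ | _) (_ | _) <;> simp [h]

/-- Writing the gate as `V D V*`, only D needs a control: with the control off, V and its adjoint
cancel. For two qubits a controlled D would touch three qubits, so D is split into single-qubit
phases, one of them conjugated by `cnot` to read the parity. -/
theorem Gate.exists_isControlled (g : Gate ι) :
    ∃ c : Circuit (Option ι), c.length ≤ 7 ∧ IsControlled c [g] := by
  cases g with
  | one p U =>
    obtain ⟨V, d, rfl⟩ := exists_eq_mul_phases_mul_star U
    refine ⟨[(Gate.one p (star V)).map Embedding.some,
      Gate.two none (some p) (by simp) (phases fun b => if b.1 then d b.2 else 1),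
      (Gate.one p V).map Embedding.some], by simp, fun Ψ => ⟨?_, ?_⟩⟩
    · simp only [Circuit.run_cons, Circuit.run_nil, (isSlice_withControl _).apply_map]
      have (Φ : (Option ι → Bool) → ℂ) :
          (Gate.two none (some p) (by simp) (phases fun b => if b.1 then d b.2 else 1)).apply Φ ∘
            withControl false = Φ ∘ withControl false := by
        funext y
        simp [Gate.apply_phases, withControl]
      rw [this, (isSlice_withControl _).apply_map, ← Gate.apply_one_mul, Unitary.mul_star_self,
        Gate.apply_one_one]
    · simp only [Circuit.run_cons, Circuit.run_nil, (isSlice_withControl _).apply_map]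
      have (Φ : (Option ι → Bool) → ℂ) :
          (Gate.two none (some p) (by simp) (phases fun b => if b.1 then d b.2 else 1)).apply Φ ∘
            withControl true = (Gate.one p (phases d)).apply (Φ ∘ withControl true) := by
        funext y
        simp [Gate.apply_phases, Gate.apply_phases_one, withControl]
      rw [this, (isSlice_withControl _).apply_map, ← Gate.apply_one_mul, ← Gate.apply_one_mul,
        mul_assoc]
  | two p q hpq U =>
    obtain ⟨V, d, rfl⟩ := exists_eq_mul_phases_mul_star U
    obtain ⟨α, β, γ, hd⟩ := exists_circle_factorization d
    refine ⟨[(Gate.two p q hpq (star V)).map Embedding.some,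
      Gate.two none (some p) (by simp) (phases fun b => if b.1 then α b.2 else 1),
      Gate.two none (some q) (by simp) (phases fun b => if b.1 then β b.2 else 1),
      (Gate.two p q hpq cnot).map Embedding.some,
      Gate.two none (some q) (by simp) (phases fun b => if b.1 then γ b.2 else 1),
      (Gate.two p q hpq cnot).map Embedding.some,
      (Gate.two p q hpq V).map Embedding.some], by simp, fun Ψ => ⟨?_, ?_⟩⟩
    · simp only [Circuit.run_cons, Circuit.run_nil, (isSlice_withControl _).apply_map]
      have key (r : ι) (δ : Bool → Circle) (Φ : (Option ι → Bool) → ℂ) :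
          (Gate.two none (some r) (by simp) (phases fun b => if b.1 then δ b.2 else 1)).apply Φ ∘
            withControl false = Φ ∘ withControl false := by
        funext y
        simp [Gate.apply_phases, withControl]
      have hcnot (Φ : (ι → Bool) → ℂ) : (Gate.two p q hpq cnot).apply
          ((Gate.two p q hpq cnot).apply Φ) = Φ := by
        funext y
        simp [Gate.apply_cnot, hpq]
      rw [key, (isSlice_withControl _).apply_map, hcnot, key, key,
        (isSlice_withControl _).apply_map, ← Gate.apply_two_mul, Unitary.mul_star_self,
        Gate.apply_two_one]
    · simp only [Circuit.run_cons, Circuit.run_nil, (isSlice_withControl _).apply_map]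
      have key (r : ι) (δ : Bool → Circle) (Φ : (Option ι → Bool) → ℂ) :
          (Gate.two none (some r) (by simp) (phases fun b => if b.1 then δ b.2 else 1)).apply Φ ∘
            withControl true = (Gate.one r (phases δ)).apply (Φ ∘ withControl true) := by
        funext y
        simp [Gate.apply_phases, Gate.apply_phases_one, withControl]
      -- Between the two `cnot` gates qubit q holds the parity, so γ is evaluated at `xor (x p) (x
      -- q)`.
      have hphases (Φ : (ι → Bool) → ℂ) : (Gate.two p q hpq cnot).apply
          ((Gate.one q (phases γ)).apply ((Gate.two p q hpq cnot).apply
            ((Gate.one q (phases β)).apply ((Gate.one p (phases α)).apply Φ)))) =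
          (Gate.two p q hpq (phases d)).apply Φ := by
        funext y
        simp only [Gate.apply_cnot, Gate.apply_phases_one, Gate.apply_phases, update_self,
          update_idem, update_of_ne hpq, ← hd, Circle.coe_mul]
        simp
        ring
      rw [key, (isSlice_withControl _).apply_map, key, key, hphases,
        (isSlice_withControl _).apply_map, ← Gate.apply_two_mul, ← Gate.apply_two_mul, mul_assoc]

theorem Circuit.exists_isControlled (c : Circuit ι) :
    ∃ c' : Circuit (Option ι), c'.length ≤ 7 * c.length ∧ IsControlled c' c := by
  induction c with
  | nil => exact ⟨[], by simp, fun Ψ => by simp [Circuit.run_nil]⟩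
  | cons g c ih =>
    obtain ⟨d, hd, hdc⟩ := g.exists_isControlled
    obtain ⟨c', hc', hcc⟩ := ih
    refine ⟨d ++ c', by simp; omega, fun Ψ => ?_⟩
    rw [Circuit.run_append, (hcc _).1, (hcc _).2, (hdc _).1, (hdc _).2]
    simp [Circuit.run_cons, Circuit.run_nil]

end Control

/-! ### A good filtering time by averaging. -/

section Averaging

/-- This yields the factor 19/20 = (1 + 9/10)/2. Up to x = 2 it follows from `sin x = 2 sin(x/2)
cos(x/2)` and `cos(x/2) ≤ 1/√(x²/4 + 1) ≤ 9/10`. -/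
theorem sin_le_of_one_le {x : ℝ} (hx : 1 ≤ x) : Real.sin x ≤ 9 / 10 * x := by
  rcases le_total 2 x with h2 | h2
  · linarith [Real.sin_le_one x]
  · have hpi := Real.pi_gt_three
    have h1 : Real.sin (x / 2) ≤ x / 2 := Real.sin_le (by linarith)
    have h3 : Real.cos (x / 2) ≤ 9 / 10 := by
      refine (Real.cos_lt_one_div_sqrt_sq_add_one (x := x / 2) (by linarith) (by linarith)
        (by linarith)).le.trans ?_
      rw [div_le_iff₀ (by positivity)]
      have : (10 / 9 : ℝ) ≤ √((x / 2) ^ 2 + 1) := Real.le_sqrt_of_sq_le (by nlinarith)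
      linarith
    have h4 : 0 ≤ Real.sin (x / 2) :=
      Real.sin_nonneg_of_nonneg_of_le_pi (by linarith) (by linarith)
    have h5 : Real.sin x = 2 * Real.sin (x / 2) * Real.cos (x / 2) := by
      rw [← Real.sin_two_mul]
      congr 1
      ring
    rw [h5]
    nlinarith

/-- Among the times in `[0, 1/Δ]` some time filters frequencies at least `Δ` as well as the
average time does. -/
theorem exists_time_sum_le {n : Type} (T : Finset n) (p ω : n → ℝ) {Δ : ℝ} (hΔ : 0 < Δ)
    (hp : ∀ k ∈ T, 0 ≤ p k) (hω : ∀ k ∈ T, Δ ≤ ω k) :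
    ∃ s, 0 ≤ s ∧ s ≤ 1 / Δ ∧
      ∑ k ∈ T, (1 + Real.cos (ω k * s)) / 2 * p k ≤ 19 / 20 * ∑ k ∈ T, p k := by
  -- If every time failed, the difference of the two sides would have positive integral over `[0,
  -- 1/Δ]`, yet each summand integrates to something nonpositive.
  by_contra! hcon
  have hL : 0 < 1 / Δ := by positivity
  have hpos : 0 < ∫ s in (0 : ℝ)..(1 / Δ),
      ∑ k ∈ T, ((1 + Real.cos (ω k * s)) / 2 * p k - 19 / 20 * p k) := by
    refine intervalIntegral.intervalIntegral_pos_of_pos_on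
      (Continuous.intervalIntegrable (by fun_prop) _ _) (fun s hs => ?_) hL
    have := hcon s hs.1.le hs.2.le
    rw [Finset.sum_sub_distrib, ← Finset.mul_sum]
    linarith
  rw [intervalIntegral.integral_finsetSum
    fun k _ => Continuous.intervalIntegrable (by fun_prop) _ _] at hpos
  refine hpos.not_ge (Finset.sum_nonpos fun k hk => ?_)
  have hωk : 0 < ω k := hΔ.trans_le (hω k hk)
  have hint : ∫ s in (0 : ℝ)..(1 / Δ), ((1 + Real.cos (ω k * s)) / 2 * p k - 19 / 20 * p k) =
      p k * (Real.sin (ω k * (1 / Δ)) / ω k - 9 / 10 * (1 / Δ)) / 2 := by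
    have hd : ∀ s ∈ Set.uIcc (0 : ℝ) (1 / Δ), HasDerivAt
        (fun s => p k * (Real.sin (ω k * s) / ω k - 9 / 10 * s) / 2)
        ((1 + Real.cos (ω k * s)) / 2 * p k - 19 / 20 * p k) s := by
      intro s _
      have h0 (c : ℝ) : HasDerivAt (fun s => c * s) c s := by
        simpa using (hasDerivAt_id s).const_mul c
      have h := ((((h0 (ω k)).sin.div_const (ω k)).sub (h0 (9 / 10))).const_mul (p k)).div_const 2
      refine h.congr_deriv ?_
      rw [mul_div_cancel_right₀ _ hωk.ne']
      ring
    rw [intervalIntegral.integral_eq_sub_of_hasDerivAt hd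
      (Continuous.intervalIntegrable (by fun_prop) _ _)]
    simp
  rw [hint]
  have hx : 1 ≤ ω k * (1 / Δ) := by
    rw [mul_one_div, one_le_div hΔ]
    exact hω k hk
  have h1 : Real.sin (ω k * (1 / Δ)) / ω k ≤ 9 / 10 * (1 / Δ) := by
    rw [div_le_iff₀ hωk]
    linarith [sin_le_of_one_le hx]
  have := mul_nonneg (hp k hk) (sub_nonneg.2 h1)
  linarith

end Averaging

/-! ### Evolution in the eigenbasis. -/

section Spectral

variable {ι : Type} [Fintype ι] [DecidableEq ι]

theorem act_sub (A : Matrix (ι → Bool) (ι → Bool) ℂ) (ψ ξ : QState ι) :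
    act A (ψ - ξ) = act A ψ - act A ξ :=
  map_sub (Matrix.toEuclideanLin A) ψ ξ

/-- A matrix that is diagonal in an orthonormal basis multiplies the coefficients. -/
theorem inner_act_of_forall_act_eq (u : OrthonormalBasis (ι → Bool) ℂ (QState ι))
    {A : Matrix (ι → Bool) (ι → Bool) ℂ} {f : (ι → Bool) → ℂ} (hf : ∀ k, act A (u k) = f k • u k)
    (k : ι → Bool) (ψ : QState ι) : inner ℂ (u k) (act A ψ) = f k * inner ℂ (u k) ψ := by
  have h : act A ψ = ∑ j, (f j * inner ℂ (u j) ψ) • u j := by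
    conv_lhs => rw [← u.sum_repr' ψ]
    change Matrix.toEuclideanLin A _ = _
    rw [map_sum]
    refine Finset.sum_congr rfl fun j _ => ?_
    rw [map_smul]
    change _ • act A (u j) = _
    rw [hf, smul_smul, mul_comm]
  rw [h, u.orthonormal.inner_right_fintype]

variable {H : Matrix (ι → Bool) (ι → Bool) ℂ} (hH : H.IsHermitian)

theorem act_eigenvectorBasis (k : ι → Bool) :
    act H (hH.eigenvectorBasis k) = (hH.eigenvalues k : ℂ) • hH.eigenvectorBasis k := by
  ext x
  have := congrFun (hH.mulVec_eigenvectorBasis k) x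
  simpa [act] using this

theorem exp_smul_mulVec_eigenvectorBasis (z : ℂ) (k : ι → Bool) :
    act (NormedSpace.exp (z • H)) (hH.eigenvectorBasis k) =
      Complex.exp (z * hH.eigenvalues k) • hH.eigenvectorBasis k := by
  have hu : IsUnit (hH.eigenvectorUnitary : Matrix (ι → Bool) (ι → Bool) ℂ) :=
    (Unitary.toUnits hH.eigenvectorUnitary).isUnit
  have hinv : (hH.eigenvectorUnitary : Matrix (ι → Bool) (ι → Bool) ℂ)⁻¹ =
      star (hH.eigenvectorUnitary : Matrix (ι → Bool) (ι → Bool) ℂ) :=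
    Matrix.inv_eq_left_inv (Unitary.coe_star_mul_self _)
  have hexp : NormedSpace.exp (z • H) =
      (hH.eigenvectorUnitary : Matrix (ι → Bool) (ι → Bool) ℂ) *
        Matrix.diagonal (fun j => Complex.exp (z * hH.eigenvalues j)) *
        star (hH.eigenvectorUnitary : Matrix (ι → Bool) (ι → Bool) ℂ) := by
    conv_lhs => rw [hH.spectral_theorem, Unitary.conjStarAlgAut_apply, ← hinv, ← Matrix.smul_mul,
      ← Matrix.mul_smul, Matrix.exp_conj _ _ hu, ← Matrix.diagonal_smul, Matrix.exp_diagonal, hinv]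
    congr 3
    funext j
    rw [Pi.coe_exp, ← Complex.exp_eq_exp_ℂ]
    simp
  ext x
  simp only [act, hexp, ← Matrix.mulVec_mulVec]
  have h1 := hH.star_eigenvectorUnitary_mulVec k
  have h2 := hH.eigenvectorUnitary_mulVec k
  rw [h1, Matrix.diagonal_mulVec_single, mul_one, ← mul_one (Complex.exp _), ← smul_eq_mul,
    Pi.single_smul, Matrix.mulVec_smul, h2]
  simp

end Spectral

/-! ### The filter and the excited weight. -/

section Filter

variable {N : ℕ} {H : Matrix (Fin N → Bool) (Fin N → Bool) ℂ} (hH : H.IsHermitian)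

theorem inner_act_evolution (s : ℝ) (k : Fin N → Bool) (ψ : QState (Fin N)) :
    inner ℂ (hH.eigenvectorBasis k) (act (evolution H s) ψ) =
      Complex.exp (-(Complex.I * s) * hH.eigenvalues k) *
        inner ℂ (hH.eigenvectorBasis k) ψ :=
  inner_act_of_forall_act_eq _ (exp_smul_mulVec_eigenvectorBasis hH _) k ψ

/-- The filter `(1 + e^{-i (H - E) s}) / 2`. -/
noncomputable def cosFilter (H : Matrix (Fin N → Bool) (Fin N → Bool) ℂ) (E s : ℝ)
    (ψ : QState (Fin N)) : QState (Fin N) :=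
  (1 / 2 : ℂ) • (ψ + Complex.exp (((E * s : ℝ) : ℂ) * Complex.I) • act (evolution H s) ψ)

theorem cosFilter_sub (E s : ℝ) (ψ ξ : QState (Fin N)) :
    cosFilter H E s (ψ - ξ) = cosFilter H E s ψ - cosFilter H E s ξ := by
  simp only [cosFilter, act_sub, smul_sub, smul_add]
  abel

theorem inner_cosFilter (E s : ℝ) (k : Fin N → Bool) (ψ : QState (Fin N)) :
    inner ℂ (hH.eigenvectorBasis k) (cosFilter H E s ψ) =
      (1 + Complex.exp (((-((hH.eigenvalues k - E) * s) : ℝ) : ℂ) * Complex.I)) / 2 *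
        inner ℂ (hH.eigenvectorBasis k) ψ := by
  rw [cosFilter, inner_smul_right, inner_add_right, inner_smul_right, inner_act_evolution,
    ← mul_assoc (Complex.exp _), ← Complex.exp_add]
  have : ((E * s : ℝ) : ℂ) * Complex.I + -(Complex.I * s) * hH.eigenvalues k =
      ((-((hH.eigenvalues k - E) * s) : ℝ) : ℂ) * Complex.I := by
    push_cast
    ring
  rw [this]
  ring

theorem norm_sq_one_add_exp_div_two (x : ℝ) :
    ‖(1 + Complex.exp ((x : ℂ) * Complex.I)) / 2‖ ^ 2 = (1 + Real.cos x) / 2 := by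
  rw [← Complex.normSq_eq_norm_sq, Complex.normSq_apply]
  simp only [Complex.div_ofNat_re, Complex.div_ofNat_im, Complex.add_re, Complex.add_im,
    Complex.one_re, Complex.one_im, Complex.exp_ofReal_mul_I_re, Complex.exp_ofReal_mul_I_im]
  nlinarith [Real.sin_sq_add_cos_sq x]

theorem norm_sq_inner_cosFilter (E s : ℝ) (k : Fin N → Bool) (ψ : QState (Fin N)) :
    ‖inner ℂ (hH.eigenvectorBasis k) (cosFilter H E s ψ)‖ ^ 2 =
      (1 + Real.cos ((hH.eigenvalues k - E) * s)) / 2 *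
        ‖inner ℂ (hH.eigenvectorBasis k) ψ‖ ^ 2 := by
  rw [inner_cosFilter, norm_mul, mul_pow, norm_sq_one_add_exp_div_two, Real.cos_neg]

/-- Each eigencomponent is multiplied by a factor of modulus at most 1. This keeps errors of earlier
rounds from growing. -/
theorem norm_cosFilter_le (hH' : H.IsHermitian) (E s : ℝ) (ψ : QState (Fin N)) :
    ‖cosFilter H E s ψ‖ ≤ ‖ψ‖ := by
  refine (sq_le_sq₀ (norm_nonneg _) (norm_nonneg _)).1 ?_
  rw [← hH'.eigenvectorBasis.sum_sq_norm_inner_right, ← hH'.eigenvectorBasis.sum_sq_norm_inner_right]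
  refine Finset.sum_le_sum fun k _ => ?_
  rw [norm_sq_inner_cosFilter]
  refine mul_le_of_le_one_left (by positivity) ?_
  linarith [Real.cos_le_one ((hH'.eigenvalues k - E) * s)]

/-- The weight of a state outside of the basis state `i₀`. -/
noncomputable def weightOff (u : OrthonormalBasis (Fin N → Bool) ℂ (QState (Fin N)))
    (i₀ : Fin N → Bool) (ψ : QState (Fin N)) : ℝ :=
  ∑ k ∈ Finset.univ.erase i₀, ‖inner ℂ (u k) ψ‖ ^ 2

/-- Parseval. For an output vector the left side is P - PF, the probability of a wrong success. -/
theorem norm_sq_sub_eq_weightOff (u : OrthonormalBasis (Fin N → Bool) ℂ (QState (Fin N)))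
    (i₀ : Fin N → Bool) (ψ : QState (Fin N)) :
    ‖ψ‖ ^ 2 - ‖inner ℂ (u i₀) ψ‖ ^ 2 = weightOff u i₀ ψ := by
  rw [← u.sum_sq_norm_inner_right, weightOff, ← Finset.add_sum_erase _ _ (Finset.mem_univ i₀)]
  ring

theorem weightOff_eq_norm_sq (u : OrthonormalBasis (Fin N → Bool) ℂ (QState (Fin N)))
    (i₀ : Fin N → Bool) (ψ : QState (Fin N)) :
    weightOff u i₀ ψ = ‖ψ - inner ℂ (u i₀) ψ • u i₀‖ ^ 2 := by
  rw [← u.sum_sq_norm_inner_right, weightOff, ← Finset.add_sum_erase _ _ (Finset.mem_univ i₀)]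
  have h0 : inner ℂ (u i₀) (ψ - inner ℂ (u i₀) ψ • u i₀) = 0 := by
    rw [inner_sub_right, inner_smul_right, u.inner_eq_one, mul_one, sub_self]
  rw [h0, norm_zero, zero_pow two_ne_zero, zero_add]
  refine Finset.sum_congr rfl fun k hk => ?_
  rw [inner_sub_right, inner_smul_right, u.inner_eq_zero (Finset.ne_of_mem_erase hk), mul_zero,
    sub_zero]

/-- The weight is the squared norm of an orthogonal projection, which is linear and contractive.
With both projected norms a, b at most 1, `a² - b² = (a + b)(a - b) ≤ 2ε`. -/
theorem weightOff_le_add (u : OrthonormalBasis (Fin N → Bool) ℂ (QState (Fin N)))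
    (i₀ : Fin N → Bool) {ψ ξ : QState (Fin N)} {ε : ℝ} (h : ‖ψ - ξ‖ ≤ ε)
    (hψ : ‖ψ‖ ≤ 1) (hξ : weightOff u i₀ ξ ≤ 1) :
    weightOff u i₀ ψ ≤ weightOff u i₀ ξ + 2 * ε := by
  have hψ' : weightOff u i₀ ψ ≤ 1 := by
    rw [← norm_sq_sub_eq_weightOff]
    nlinarith [sq_nonneg ‖inner ℂ (u i₀) ψ‖, norm_nonneg ψ]
  have hd : weightOff u i₀ (ψ - ξ) ≤ ε ^ 2 := by
    rw [← norm_sq_sub_eq_weightOff]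
    nlinarith [sq_nonneg ‖inner ℂ (u i₀) (ψ - ξ)‖, norm_nonneg (ψ - ξ)]
  have hε : 0 ≤ ε := (norm_nonneg _).trans h
  rw [weightOff_eq_norm_sq] at *
  rw [weightOff_eq_norm_sq] at *
  set a := ψ - inner ℂ (u i₀) ψ • u i₀ with ha
  set b := ξ - inner ℂ (u i₀) ξ • u i₀ with hb
  have hab : ψ - ξ - inner ℂ (u i₀) (ψ - ξ) • u i₀ = a - b := by
    rw [ha, hb, inner_sub_right, sub_smul]
    abel
  rw [hab] at hd
  have hd' : ‖a - b‖ ≤ ε := (sq_le_sq₀ (norm_nonneg _) hε).1 hd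
  have h1 := norm_sub_norm_le a b
  have h2 : ‖a‖ ≤ 1 := (sq_le_one_iff₀ (norm_nonneg _)).1 hψ'
  have h3 : ‖b‖ ≤ 1 := (sq_le_one_iff₀ (norm_nonneg _)).1 hξ
  nlinarith [norm_nonneg a, norm_nonneg b]

theorem weightOff_cosFilter_le {i₀ : Fin N → Bool} {Δ : ℝ} (hΔ : 0 < Δ)
    (hgap : ∀ j, j ≠ i₀ → Δ ≤ hH.eigenvalues j - hH.eigenvalues i₀) (ψ : QState (Fin N)) :
    ∃ s, 0 ≤ s ∧ s ≤ 1 / Δ ∧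
      weightOff hH.eigenvectorBasis i₀ (cosFilter H (hH.eigenvalues i₀) s ψ) ≤
        19 / 20 * weightOff hH.eigenvectorBasis i₀ ψ := by
  obtain ⟨s, hs0, hs1, hs⟩ := exists_time_sum_le (Finset.univ.erase i₀)
    (fun k => ‖inner ℂ (hH.eigenvectorBasis k) ψ‖ ^ 2)
    (fun k => hH.eigenvalues k - hH.eigenvalues i₀) hΔ (fun _ _ => by positivity)
    (fun k hk => hgap k (Finset.ne_of_mem_erase hk))
  refine ⟨s, hs0, hs1, ?_⟩
  simpa only [weightOff, norm_sq_inner_cosFilter] using hs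

/-- The ground state of a gapped Hamiltonian is the eigenbasis state up to a phase. -/
theorem IsGroundState.norm_inner_eq {hH : H.IsHermitian} {φ₀ : QState (Fin N)}
    (h : IsGroundState hH φ₀) {i₀ : Fin N → Bool} {Δ : ℝ} (hΔ : 0 < Δ)
    (hgap : ∀ j, j ≠ i₀ → Δ ≤ hH.eigenvalues j - hH.eigenvalues i₀) (ψ : QState (Fin N)) :
    ‖inner ℂ φ₀ ψ‖ = ‖inner ℂ (hH.eigenvectorBasis i₀) ψ‖ := by
  obtain ⟨hnorm, i, hi, hact⟩ := h
  -- The positive gap makes the index of the least eigenvalue unique.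
  obtain rfl : i = i₀ := by
    by_contra hne
    linarith [hi i₀, hgap i hne]
  set u := hH.eigenvectorBasis
  have hz : ∀ j, j ≠ i → inner ℂ (u j) φ₀ = 0 := by
    intro j hj
    have h1 := inner_act_of_forall_act_eq u (act_eigenvectorBasis hH) j φ₀
    rw [hact, inner_smul_right] at h1
    have h2 : ((hH.eigenvalues j : ℂ) - hH.eigenvalues i) * inner ℂ (u j) φ₀ = 0 := by
      rw [sub_mul, h1, sub_self]
    refine (mul_eq_zero.1 h2).resolve_left fun h3 => ?_
    have h4 : hH.eigenvalues j - hH.eigenvalues i = 0 := by exact_mod_cast h3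
    linarith [hgap j hj]
  have hφ : φ₀ = inner ℂ (u i) φ₀ • u i := by
    conv_lhs => rw [← u.sum_repr' φ₀]
    refine Finset.sum_eq_single i (fun j _ hj => ?_) (by simp)
    rw [hz j hj, zero_smul]
  have h1 : ‖inner ℂ (u i) φ₀‖ = 1 := by
    rw [hφ, norm_smul, u.norm_eq_one, mul_one] at hnorm
    exact hnorm
  rw [hφ, inner_smul_left, norm_mul, RCLike.norm_conj, h1, one_mul]

end Filter

/-! ### The Hadamard test with postselected ancillas. -/

section Step

variable {N : ℕ} {α : Type} [Fintype α] [DecidableEq α]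

/-- The unnormalized state of the output register after all ancillas are found in `0`. -/
noncomputable def ancillaOut (Ψ : QState (Fin N ⊕ α)) : QState (Fin N) :=
  WithLp.toLp 2 fun x => Ψ (Sum.elim x (fun _ => false))

theorem ancillaOut_sub (Ψ Φ : QState (Fin N ⊕ α)) :
    ancillaOut (Ψ - Φ) = ancillaOut Ψ - ancillaOut Φ := rfl

theorem ancillaOut_withAncillas (a : ℕ) (ψ : QState (Fin N)) :
    ancillaOut (withAncillas a ψ) = ψ := by
  ext x
  simp [ancillaOut, withAncillas]

theorem norm_ancillaOut_le (Ψ : QState (Fin N ⊕ α)) : ‖ancillaOut Ψ‖ ≤ ‖Ψ‖ := by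
  refine (sq_le_sq₀ (norm_nonneg _) (norm_nonneg _)).1 ?_
  rw [EuclideanSpace.norm_sq_eq, EuclideanSpace.norm_sq_eq]
  have hinj : Injective fun x : Fin N → Bool => (Sum.elim x (fun _ => false) : Fin N ⊕ α → Bool) :=
    fun x y h => funext fun i => congrFun h (Sum.inl i)
  refine le_of_eq_of_le (Finset.sum_map Finset.univ ⟨_, hinj⟩ fun b => ‖Ψ b‖ ^ 2).symm ?_
  exact Finset.sum_le_sum_of_subset_of_nonneg (Finset.subset_univ _) fun _ _ _ => by positivity

/-- The state of the output register on success of the circuit `A`. -/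
noncomputable def output (A : Circuit (Fin N ⊕ α)) : QState (Fin N) :=
  ancillaOut (act (Circuit.toMatrix A) (zeroState (Fin N ⊕ α)))

theorem norm_zeroState (ι : Type) [Fintype ι] [DecidableEq ι] : ‖zeroState ι‖ = 1 := by
  simp [zeroState]

theorem norm_output_le (A : Circuit (Fin N ⊕ α)) : ‖output A‖ ≤ 1 :=
  (norm_ancillaOut_le _).trans <| by
    rw [norm_act_of_mem_unitaryGroup A.toMatrix_mem_unitaryGroup, norm_zeroState]

/-- The amplitudes of `|0…0⟩`. -/
noncomputable def zeroAmp (ι : Type) [Fintype ι] [DecidableEq ι] (b : ι → Bool) : ℂ :=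
  if ∀ i, b i = false then 1 else 0

theorem output_apply (A : Circuit (Fin N ⊕ α)) (x : Fin N → Bool) :
    output A x = Circuit.run A (zeroAmp (Fin N ⊕ α)) (Sum.elim x (fun _ => false)) := by
  have : (fun b => zeroState (Fin N ⊕ α) b) = zeroAmp (Fin N ⊕ α) := by
    funext b
    simp [zeroState, zeroAmp, funext_iff]
  simp [output, ancillaOut, act, Circuit.run, this]

theorem inv_sqrt_two_mul_self : ((√2 : ℝ) : ℂ)⁻¹ * ((√2 : ℝ) : ℂ)⁻¹ = 1 / 2 := by
  rw [← mul_inv, ← Complex.ofReal_mul, Real.mul_self_sqrt zero_le_two]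
  norm_num

/-- The Hadamard gate. -/
noncomputable def hadamard : Matrix.unitaryGroup Bool ℂ :=
  ⟨Matrix.of fun b b' => (if b && b' then -1 else 1) * ((√2 : ℝ) : ℂ)⁻¹, by
    rw [Matrix.mem_unitaryGroup_iff]
    ext a b
    cases a <;> cases b <;> simp [Matrix.mul_apply, inv_sqrt_two_mul_self]
    all_goals norm_num⟩

theorem Gate.apply_one_withControl {ι : Type} [Fintype ι] [DecidableEq ι]
    (G : Matrix.unitaryGroup Bool ℂ) (Ψ : (Option ι → Bool) → ℂ) (b : Bool) :
    (Gate.one none G).apply Ψ ∘ withControl b =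
      (G : Matrix Bool Bool ℂ) b false • (Ψ ∘ withControl false) +
        (G : Matrix Bool Bool ℂ) b true • (Ψ ∘ withControl true) := by
  have h (b' : Bool) (y : ι → Bool) :
      update (withControl b y) none b' = withControl b' y := by
    funext o
    cases o <;> simp [withControl]
  funext y
  simp [Gate.apply, h, withControl, add_comm]

/-- The Hadamard test: the circuit `c` is applied under control of a fresh ancilla. -/
theorem exists_hadamardTest {ι : Type} [Fintype ι] [DecidableEq ι] (c : Circuit ι) (z : Circle) :
    ∃ c' : Circuit (Option ι), c'.length ≤ 7 * c.length + 2 ∧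
      ∀ Ψ, Ψ ∘ withControl true = 0 →
        Circuit.run c' Ψ ∘ withControl false =
          (1 / 2 : ℂ) • (Ψ ∘ withControl false +
            (z : ℂ) • Circuit.run c (Ψ ∘ withControl false)) := by
  obtain ⟨c', hlen, hc'⟩ := c.exists_isControlled
  refine ⟨Gate.one none hadamard ::
    (c' ++ [Gate.one none (hadamard * phases fun b => if b then z else 1)]), by simp; omega,
    fun Ψ hΨ => ?_⟩
  rw [Circuit.run_cons, Circuit.run_append, Circuit.run_cons, Circuit.run_nil,
    Gate.apply_one_withControl, (hc' _).1, (hc' _).2, Gate.apply_one_withControl,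
    Gate.apply_one_withControl, hΨ, smul_zero, add_zero, smul_zero, add_zero, Circuit.run_smul,
    smul_smul, smul_smul]
  -- The phase z is merged into the closing Hadamard gate, so the test adds just two gates to the
  -- controlled circuit.
  have h1 : (hadamard : Matrix Bool Bool ℂ) false false = ((√2 : ℝ) : ℂ)⁻¹ := by simp [hadamard]
  have h2 : (hadamard : Matrix Bool Bool ℂ) true false = ((√2 : ℝ) : ℂ)⁻¹ := by simp [hadamard]
  have h3 : ((hadamard * phases fun b => if b then z else 1 : Matrix.unitaryGroup Bool ℂ) :
      Matrix Bool Bool ℂ) false false = ((√2 : ℝ) : ℂ)⁻¹ := by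
    simp [hadamard, phases]
  have h4 : ((hadamard * phases fun b => if b then z else 1 : Matrix.unitaryGroup Bool ℂ) :
      Matrix Bool Bool ℂ) false true = ((√2 : ℝ) : ℂ)⁻¹ * z := by
    simp [hadamard, phases]
  rw [h1, h2, h3, h4, inv_sqrt_two_mul_self, mul_right_comm, inv_sqrt_two_mul_self, smul_add,
    smul_smul]

/-- The qubits of a Hadamard test within the register extended by its fresh ancillas. -/
def testQubits (α : Type) (N a : ℕ) : Option (Fin N ⊕ Fin a) ↪ Fin N ⊕ (α ⊕ Option (Fin a)) where
  toFun o := o.elim (Sum.inr (Sum.inr none))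
    (Sum.elim Sum.inl fun j => Sum.inr (Sum.inr (some j)))
  inj' := by rintro (_ | _ | _) (_ | _ | _) h <;> simp_all

/-- The old qubits within the register extended by fresh ancillas. -/
def oldQubits (α β : Type) (N : ℕ) : Fin N ⊕ α ↪ Fin N ⊕ (α ⊕ β) where
  toFun := Sum.elim Sum.inl fun j => Sum.inr (Sum.inl j)
  inj' := by rintro (_ | _) (_ | _) h <;> simp_all

@[simp] theorem testQubits_none (a : ℕ) : testQubits α N a none = Sum.inr (Sum.inr none) := rfl

@[simp] theorem testQubits_some_inl (a : ℕ) (i : Fin N) :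
    testQubits α N a (some (Sum.inl i)) = Sum.inl i := rfl

@[simp] theorem testQubits_some_inr (a : ℕ) (j : Fin a) :
    testQubits α N a (some (Sum.inr j)) = Sum.inr (Sum.inr (some j)) := rfl

/-- The old ancillas are frozen at `false`, the value required by the final measurement; the test
never touches them, so measuring them can be deferred. -/
theorem isSlice_testQubits (a : ℕ) : IsSlice (testQubits α N a) fun y =>
    Sum.elim (fun i => y (some (Sum.inl i))) (Sum.elim (fun _ => false)
      fun o => o.elim (y none) fun j => y (some (Sum.inr j))) := by
  intro y p b
  funext k
  rcases p with _ | p | p <;> rcases k with k | k | _ | k <;>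
    simp [update_apply]

@[simp] theorem oldQubits_inl (β : Type) (i : Fin N) :
    oldQubits α β N (Sum.inl i) = Sum.inl i := rfl

@[simp] theorem oldQubits_inr (β : Type) (j : α) :
    oldQubits α β N (Sum.inr j) = Sum.inr (Sum.inl j) := rfl

theorem isSlice_oldQubits {β : Type} [DecidableEq β] (z : β → Bool) :
    IsSlice (oldQubits α β N) fun y =>
      Sum.elim (fun i => y (Sum.inl i)) (Sum.elim (fun i => y (Sum.inr i)) z) := by
  intro y p b
  funext k
  rcases p with p | p <;> rcases k with k | k | k <;> simp [update_apply]

/-- A Hadamard test on the output register of `A`, with fresh ancillas. -/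
theorem exists_output_eq_hadamardTest (A : Circuit (Fin N ⊕ α)) {a : ℕ}
    (c : Circuit (Fin N ⊕ Fin a)) (z : Circle) :
    ∃ A' : Circuit (Fin N ⊕ (α ⊕ Option (Fin a))), A'.length ≤ A.length + (7 * c.length + 2) ∧
      output A' = (1 / 2 : ℂ) • (output A +
        (z : ℂ) • ancillaOut (act (Circuit.toMatrix c) (withAncillas a (output A)))) := by
  obtain ⟨c', hlen, hc'⟩ := exists_hadamardTest c z
  refine ⟨A.map (Gate.map (oldQubits α _ N)) ++ c'.map (Gate.map (testQubits α N a)),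
    by simpa using hlen, ?_⟩
  -- The circuit A leaves the fresh ancillas alone, so the amplitude vanishes unless they are all
  -- still 0.
  have hold (v : Option (Fin a) → Bool) (x : Fin N → Bool) :
      Circuit.run (A.map (Gate.map (oldQubits α _ N))) (zeroAmp _)
        (Sum.elim x (Sum.elim (fun _ => false) v)) =
      if ∀ o, v o = false then output A x else 0 := by
    have h := congrFun ((isSlice_oldQubits (α := α) (N := N) v).run_map A (zeroAmp _))
      (Sum.elim x fun _ => false)
    simp only [comp_apply, Sum.elim_inl, Sum.elim_inr] at h
    rw [h]
    split_ifs with hv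
    · rw [output_apply]
      congr 1
      funext y
      simp [zeroAmp, hv]
    · have : (zeroAmp (Fin N ⊕ (α ⊕ Option (Fin a))) ∘ fun y : Fin N ⊕ α → Bool =>
          (Sum.elim (fun i => y (Sum.inl i)) (Sum.elim (fun i => y (Sum.inr i)) v))) = 0 := by
        funext y
        simp only [zeroAmp, comp_apply, Pi.zero_apply, ite_eq_right_iff]
        intro h'
        exact absurd (fun o => h' (Sum.inr (Sum.inr o))) hv
      rw [this, Circuit.run_zero, Pi.zero_apply]
  have htest := fun Ψ => (isSlice_testQubits (α := α) (N := N) a).run_map c' Ψ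
  set w : (Option (Fin N ⊕ Fin a) → Bool) → Fin N ⊕ (α ⊕ Option (Fin a)) → Bool := fun y =>
    Sum.elim (fun i => y (some (Sum.inl i))) (Sum.elim (fun _ => false)
      fun o => o.elim (y none) fun j => y (some (Sum.inr j))) with hw
  set Φ := Circuit.run (A.map (Gate.map (oldQubits α (Option (Fin a)) N))) (zeroAmp _) with hΦ
  have htrue : (Φ ∘ w) ∘ withControl true = 0 := by
    funext y
    simp only [comp_apply, hw, hold, Pi.zero_apply]
    rw [if_neg]
    intro h
    simpa [withControl] using h none
  have hfalse : (Φ ∘ w) ∘ withControl false = fun b => withAncillas a (output A) b := by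
    funext y
    simp only [comp_apply, hw, hold, withAncillas]
    refine if_congr ⟨fun h j => by simpa [withControl] using h (some j), fun h o => ?_⟩ rfl rfl
    cases o with
    | none => simp [withControl]
    | some j => simpa [withControl] using h j
  ext x
  have hx : (Sum.elim x (fun _ => false) : Fin N ⊕ (α ⊕ Option (Fin a)) → Bool) =
      w (withControl false (Sum.elim x fun _ => false)) := by
    funext k
    rcases k with k | k | _ | k <;> simp [hw, withControl]
  rw [output_apply, Circuit.run_append, hx]
  have h1 := congrFun (htest Φ) (withControl false (Sum.elim x fun _ => false))
  have h2 := congrFun (hc' _ htrue) (Sum.elim x fun _ => false)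
  simp only [comp_apply] at h1
  rw [h1]
  refine h2.trans ?_
  rw [hfalse]
  simp [withAncillas, ancillaOut, act, Circuit.run, mul_add]

/-- Renaming the ancillas does not change the output. -/
theorem output_map {β : Type} [Fintype β] [DecidableEq β] (e : α ≃ β) (A : Circuit (Fin N ⊕ α)) :
    output (A.map (Gate.map ((Equiv.refl (Fin N)).sumCongr e).toEmbedding)) = output A := by
  set f := (Equiv.refl (Fin N)).sumCongr e
  have hs : IsSlice f.toEmbedding fun y => y ∘ f.symm := by
    intro y p b
    funext k
    by_cases h : k = f p
    · subst h; simp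
    · have : f.symm k ≠ p := fun h' => h (by rw [← h', f.apply_symm_apply])
      simp [h, this]
  ext x
  have hx : (Sum.elim x (fun _ => false) : Fin N ⊕ β → Bool) =
      (Sum.elim x (fun _ => false) : Fin N ⊕ α → Bool) ∘ f.symm := by
    funext k
    rcases k with k | k <;> simp [f]
  have h := congrFun (hs.run_map A (zeroAmp _)) (Sum.elim x fun _ => false)
  rw [output_apply, output_apply, hx]
  refine h.trans ?_
  congr 1
  funext y
  simp only [zeroAmp, comp_apply]
  exact if_congr (f.symm.forall_congr_right (q := fun k => y k = false)) rfl rfl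

end Step

/-! ### Iteration, error accumulation and the choice of constants. -/

section Main

variable {N : ℕ} {H : Matrix (Fin N → Bool) (Fin N → Bool) ℂ}

/-- One filtering step of the algorithm. -/
theorem Simulates.exists_output_near_cosFilter {α : Type} [Fintype α] [DecidableEq α] {a : ℕ}
    {c : Circuit (Fin N ⊕ Fin a)} {s δ : ℝ} (hc : Simulates c H s δ) (hδ : 0 ≤ δ) (E : ℝ)
    (A : Circuit (Fin N ⊕ α)) :
    ∃ A' : Circuit (Fin N ⊕ (α ⊕ Option (Fin a))), A'.length ≤ A.length + (7 * c.length + 2) ∧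
      ‖output A' - cosFilter H E s (output A)‖ ≤ δ := by
  obtain ⟨A', hlen, hA'⟩ := exists_output_eq_hadamardTest A c (Circle.exp (E * s))
  refine ⟨A', hlen, ?_⟩
  have h : output A' - cosFilter H E s (output A) =
      ((1 / 2 : ℂ) * (Circle.exp (E * s) : ℂ)) •
        ancillaOut (act (Circuit.toMatrix c) (withAncillas a (output A)) -
          withAncillas a (act (evolution H s) (output A))) := by
    rw [ancillaOut_sub, ancillaOut_withAncillas, hA', cosFilter, Circle.coe_exp]
    module
  -- Postselection does not increase norms, and the filter halves the simulation error; the factor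
  -- 1/2 is then given away.
  rw [h, norm_smul, norm_mul, Circle.norm_coe]
  have h1 := (norm_ancillaOut_le _).trans (hc (output A))
  have h2 : δ * ‖output A‖ ≤ δ := mul_le_of_le_one_right hδ (norm_output_le A)
  have h3 : ‖(1 / 2 : ℂ)‖ = 1 / 2 := by norm_num
  rw [h3]
  linarith [h1.trans h2]

/-- The vector ξ is the exactly filtered output, tracked beside the circuit. Times are chosen for ξ,
so its weight decays cleanly and δ enters only through the distance from `output A`. -/
theorem exists_filtered_output (hH : H.IsHermitian) {Δ : ℝ} (hΔ : 0 < Δ) {i₀ : Fin N → Bool}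
    (hgap : ∀ j, j ≠ i₀ → Δ ≤ hH.eigenvalues j - hH.eigenvalues i₀) {δ : ℝ} (hδ : 0 ≤ δ)
    {L : ℝ} (hL : 1 ≤ L) (hsim : ∀ s, 0 ≤ s → s ≤ 1 / Δ →
      ∃ (a : ℕ) (c : Circuit (Fin N ⊕ Fin a)), (c.length : ℝ) ≤ L ∧ Simulates c H s δ)
    {a₀ : ℕ} (c₀ : Circuit (Fin N ⊕ Fin a₀)) (r : ℕ) :
    ∃ (α : Type) (_ : Fintype α) (_ : DecidableEq α) (A : Circuit (Fin N ⊕ α))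
      (ξ : QState (Fin N)), (A.length : ℝ) ≤ c₀.length + r * (9 * L) ∧
        ‖output A - ξ‖ ≤ r * δ ∧
        inner ℂ (hH.eigenvectorBasis i₀) ξ = inner ℂ (hH.eigenvectorBasis i₀) (output c₀) ∧
        weightOff hH.eigenvectorBasis i₀ ξ ≤ (19 / 20) ^ r := by
  induction r with
  | zero =>
    refine ⟨Fin a₀, inferInstance, inferInstance, c₀, output c₀, by simp, by simp, rfl, ?_⟩
    rw [← norm_sq_sub_eq_weightOff, pow_zero]
    nlinarith [norm_nonneg (output c₀), norm_output_le c₀,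
      sq_nonneg ‖inner ℂ (hH.eigenvectorBasis i₀) (output c₀)‖]
  | succ r ih =>
    obtain ⟨α, _, _, A, ξ, hlen, herr, hinner, hoff⟩ := ih
    obtain ⟨s, hs0, hs1, hs⟩ := weightOff_cosFilter_le hH hΔ hgap ξ
    obtain ⟨a, c, hclen, hc⟩ := hsim s hs0 hs1
    obtain ⟨A', hlen', hA'⟩ := hc.exists_output_near_cosFilter hδ (hH.eigenvalues i₀) A
    refine ⟨_, inferInstance, inferInstance, A', cosFilter H (hH.eigenvalues i₀) s ξ, ?_, ?_, ?_,
      ?_⟩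
    -- Here `1 ≤ L` is needed: `7L + 2 ≤ 9L`.
    · have : (A'.length : ℝ) ≤ A.length + (7 * c.length + 2) := by exact_mod_cast hlen'
      push_cast
      linarith
    · have h1 := norm_sub_le_norm_sub_add_norm_sub (output A')
        (cosFilter H (hH.eigenvalues i₀) s (output A)) (cosFilter H (hH.eigenvalues i₀) s ξ)
      have h2 := norm_cosFilter_le hH (hH.eigenvalues i₀) s (output A - ξ)
      rw [cosFilter_sub] at h2
      push_cast
      linarith
    · rw [inner_cosFilter, hinner]
      simp
    · rw [pow_succ]
      linarith

/-- The empty circuit simulates a gapped Hamiltonian badly. -/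
theorem Simulates.le_of_nil {hH : H.IsHermitian} {Δ δ : ℝ} (hΔ : 0 < Δ) {i j : Fin N → Bool}
    (hgap : hH.eigenvalues j - hH.eigenvalues i = Δ) {a : ℕ}
    (h : Simulates ([] : Circuit (Fin N ⊕ Fin a)) H (1 / Δ) δ) : 2 / 9 ≤ δ := by
  have key (k : Fin N → Bool) :
      ‖1 - Complex.exp (-(Complex.I * ((1 / Δ : ℝ) : ℂ)) * hH.eigenvalues k)‖ ≤ δ := by
    have h1 := h (hH.eigenvectorBasis k)
    rw [hH.eigenvectorBasis.norm_eq_one, mul_one] at h1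
    have h2 := (norm_ancillaOut_le _).trans h1
    have h3 : act (Circuit.toMatrix ([] : Circuit (Fin N ⊕ Fin a)))
        (withAncillas a (hH.eigenvectorBasis k)) = withAncillas a (hH.eigenvectorBasis k) := by
      simp [act, Circuit.toMatrix]
    have h4 : act (evolution H (1 / Δ)) (hH.eigenvectorBasis k) = _ :=
      exp_smul_mulVec_eigenvectorBasis hH _ k
    rw [ancillaOut_sub, h3, ancillaOut_withAncillas, ancillaOut_withAncillas, h4] at h2
    rwa [← one_smul ℂ (hH.eigenvectorBasis k), smul_smul, mul_one, ← sub_smul, norm_smul,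
      hH.eigenvectorBasis.norm_eq_one, mul_one] at h2
  set zi := Complex.exp (-(Complex.I * ((1 / Δ : ℝ) : ℂ)) * hH.eigenvalues i) with hzi
  set zj := Complex.exp (-(Complex.I * ((1 / Δ : ℝ) : ℂ)) * hH.eigenvalues j) with hzj
  -- Both phases are δ-close to 1, but at time 1/Δ they differ by an angle of one radian; then `2δ ≥
  -- 1 - cos 1 ≥ 4/9`.
  have h1 : ‖zi - zj‖ ≤ 2 * δ := by
    have := norm_sub_le_norm_sub_add_norm_sub zi 1 zj
    rw [norm_sub_rev zi 1] at this
    linarith [key i, key j]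
  have hj : zj = zi * Complex.exp (((-1 : ℝ) : ℂ) * Complex.I) := by
    rw [hzi, hzj, ← Complex.exp_add]
    congr 1
    have : (hH.eigenvalues j : ℂ) = hH.eigenvalues i + Δ := by
      rw [← hgap]
      push_cast
      ring
    have hΔ' : (Δ : ℂ) ≠ 0 := by exact_mod_cast hΔ.ne'
    rw [this]
    push_cast
    field_simp
    ring
  have hi : ‖zi‖ = 1 := by
    have : -(Complex.I * ((1 / Δ : ℝ) : ℂ)) * hH.eigenvalues i =
        ((-(1 / Δ * hH.eigenvalues i) : ℝ) : ℂ) * Complex.I := by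
      push_cast
      ring
    rw [hzi, this, Complex.norm_exp_ofReal_mul_I]
  have h2 : ‖zi - zj‖ = ‖1 - Complex.exp (((-1 : ℝ) : ℂ) * Complex.I)‖ := by
    rw [hj, ← mul_one_sub, norm_mul, hi, one_mul]
  have h3 : 1 - Real.cos 1 ≤ ‖1 - Complex.exp (((-1 : ℝ) : ℂ) * Complex.I)‖ := by
    refine le_trans (le_of_eq ?_) (Complex.re_le_norm _)
    rw [Complex.sub_re, Complex.one_re, Complex.exp_ofReal_mul_I_re, Real.cos_neg]
  linarith [Real.cos_one_le]

theorem successOutput_eq_output {m : ℕ} (A : Circuit (Fin N ⊕ Fin m)) :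
    successOutput A = output A := rfl

theorem exists_repetitions {η : ℝ} (hη : 0 < η) (hη1 : η ≤ 1) :
    ∃ r : ℕ, (r : ℝ) ≤ 22 * Real.log (2 / η) ∧ (19 / 20 : ℝ) ^ r ≤ η := by
  have hlog : 0 ≤ Real.log (1 / η) := Real.log_nonneg (by rwa [one_le_div hη])
  refine ⟨⌈20 * Real.log (1 / η)⌉₊, ?_, ?_⟩
  -- The `log 2` inside `log (2 / η)` pays for the rounding, even at η = 1.
  · have h1 := (Nat.ceil_lt_add_one (a := 20 * Real.log (1 / η)) (by positivity)).le
    have h2 : Real.log (2 / η) = Real.log 2 + Real.log (1 / η) := by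
      rw [← Real.log_mul (by norm_num) (by positivity), mul_one_div]
    have := Real.log_two_gt_d9
    rw [h2]
    linarith
  · set r := ⌈20 * Real.log (1 / η)⌉₊
    have hr : 20 * Real.log (1 / η) ≤ r := Nat.le_ceil _
    have h1 : (19 / 20 : ℝ) ≤ Real.exp (-(1 / 20)) := by
      have := Real.add_one_le_exp (-(1 / 20 : ℝ))
      linarith
    calc (19 / 20 : ℝ) ^ r ≤ Real.exp (-(1 / 20)) ^ r := by gcongr
      _ = Real.exp (r * -(1 / 20)) := (Real.exp_nat_mul _ _).symm
      _ ≤ Real.exp (Real.log η) := by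
        rw [Real.exp_le_exp]
        rw [one_div, Real.log_inv] at hr
        linarith
      _ = η := Real.exp_log hη

end Main

end QuantumCircuit

open QuantumCircuit in
theorem mainTheorem8 :
    ∃ K : ℝ, 0 < K ∧
      ∀ (N : ℕ) (H : Matrix (Fin N → Bool) (Fin N → Bool) ℂ) (hH : H.IsHermitian)
        (Δ : ℝ) (_ : QuantumCircuit.IsSpectralGap hH Δ) (_ : 0 < Δ)
        (φ₀ : QuantumCircuit.QState (Fin N)) (_ : QuantumCircuit.IsGroundState hH φ₀)
        (δ : ℝ) (_ : 0 ≤ δ) (C : ℝ → ℝ) (_ : QuantumCircuit.IsSimulationCost H δ C)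
        (φ : QuantumCircuit.QState (Fin N)) (C₀ : ℝ)
        (_ : QuantumCircuit.PreparableWithCost φ C₀)
        (η : ℝ) (_ : 0 < η) (_ : η ≤ 1),
        ∃ (m : ℕ) (A : QuantumCircuit.Circuit (Fin N ⊕ Fin m)),
          (A.length : ℝ) ≤ K * Real.log (2 / η) * (C (1 / Δ) + C₀) ∧
          ‖inner ℂ φ₀ φ‖ ^ 2 - K * Real.log (2 / η) * δ ≤ QuantumCircuit.outputProb A φ₀ ∧
          QuantumCircuit.successProb A - QuantumCircuit.outputProb A φ₀
            ≤ η + K * Real.log (2 / η) * δ := by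
  -- The cost needs 22 · 9 = 198 (rounds times gates per round); the probability bounds need only 2
  -- · 22 = 44.
  refine ⟨200, by norm_num, ?_⟩
  intro N H hH Δ hgap hΔ φ₀ hφ₀ δ hδ C hC φ C₀ hprep η hη hη1
  obtain ⟨i₀, -, ⟨j, -, hj⟩, hleast⟩ := hgap
  have hgap' : ∀ j, j ≠ i₀ → Δ ≤ hH.eigenvalues j - hH.eigenvalues i₀ :=
    fun j hj => hleast ⟨j, hj, rfl⟩
  obtain ⟨a₀, c₀, hc₀, hφ⟩ := hprep
  have hout : output c₀ = φ := by rw [output, hφ, ancillaOut_withAncillas]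
  have hlog : 0.69 ≤ Real.log (2 / η) := by
    have h1 : Real.log 2 ≤ Real.log (2 / η) :=
      Real.log_le_log (by norm_num) (by rw [le_div_iff₀ hη]; linarith)
    linarith [Real.log_two_gt_d9]
  have hinner (ψ : QState (Fin N)) : ‖inner ℂ φ₀ ψ‖ ≤ ‖ψ‖ := by
    simpa [hφ₀.1] using norm_inner_le_norm (𝕜 := ℂ) φ₀ ψ
  have hφ1 : ‖inner ℂ φ₀ φ‖ ≤ 1 := (hinner φ).trans (hout ▸ norm_output_le c₀)
  have hC₀ : 0 ≤ C₀ := (Nat.cast_nonneg _).trans hc₀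
  set ℓ := Real.log (2 / η)
  rcases lt_or_ge (C (1 / Δ)) 1 with hC1 | hC1
  · obtain ⟨a, c, hclen, hc⟩ := hC (1 / Δ) (by positivity) (1 / Δ) (by positivity) le_rfl
    have hc0 : c.length = 0 := by
      have : (c.length : ℝ) < 1 := hclen.trans_lt hC1
      exact Nat.lt_one_iff.1 (by exact_mod_cast this)
    obtain rfl := List.eq_nil_of_length_eq_zero hc0
    have hδ' := hc.le_of_nil hΔ hj.symm
    -- The error allowance exceeds 1, so any circuit meets both probability bounds; the empty one
    -- costs nothing.
    have hbig : 1 ≤ 200 * ℓ * δ := by nlinarith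
    have hCnn : 0 ≤ C (1 / Δ) := (Nat.cast_nonneg _).trans hclen
    refine ⟨0, [], ?_, ?_, ?_⟩
    · simp only [List.length_nil, Nat.cast_zero]
      positivity
    · have h0 : 0 ≤ outputProb ([] : Circuit (Fin N ⊕ Fin 0)) φ₀ := sq_nonneg _
      nlinarith [norm_nonneg (inner ℂ φ₀ φ)]
    · have h0 : 0 ≤ outputProb ([] : Circuit (Fin N ⊕ Fin 0)) φ₀ := sq_nonneg _
      have h1 : successProb ([] : Circuit (Fin N ⊕ Fin 0)) ≤ 1 :=
        pow_le_one₀ (norm_nonneg _) (norm_output_le _)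
      linarith
  · obtain ⟨r, hr, hrη⟩ := exists_repetitions hη hη1
    obtain ⟨α, _, _, A, ξ, hlen, herr, hξ, hoff⟩ := exists_filtered_output hH hΔ hgap' hδ hC1
      (fun s hs0 hs1 => hC (1 / Δ) (by positivity) s hs0 hs1) c₀ r
    have hrδ : r * δ ≤ 22 * ℓ * δ := mul_le_mul_of_nonneg_right hr hδ
    have hℓδ : 0 ≤ ℓ * δ := by positivity
    refine ⟨Fintype.card α, A.map (Gate.map
      ((Equiv.refl (Fin N)).sumCongr (Fintype.equivFin α)).toEmbedding), ?_, ?_, ?_⟩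
    · rw [List.length_map]
      have h1 : r * (9 * C (1 / Δ)) ≤ 22 * ℓ * (9 * C (1 / Δ)) :=
        mul_le_mul_of_nonneg_right hr (by linarith)
      have h2 : 0 ≤ ℓ * C (1 / Δ) := by positivity
      have h3 : 0.69 * C₀ ≤ ℓ * C₀ := mul_le_mul_of_nonneg_right hlog hC₀
      linarith
    · rw [outputProb, successOutput_eq_output, output_map]
      have h1 : ‖inner ℂ φ₀ ξ‖ = ‖inner ℂ φ₀ φ‖ := by
        rw [hφ₀.norm_inner_eq hΔ hgap', hφ₀.norm_inner_eq hΔ hgap', hξ, hout]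
      have h2 : ‖inner ℂ φ₀ ξ‖ - ‖inner ℂ φ₀ (output A)‖ ≤ r * δ := by
        refine (norm_sub_norm_le _ _).trans ?_
        rw [← inner_sub_right]
        refine (hinner _).trans ?_
        rwa [norm_sub_rev]
      have h3 : ‖inner ℂ φ₀ (output A)‖ ≤ 1 := (hinner _).trans (norm_output_le A)
      rw [h1] at h2
      -- Both overlaps are at most 1, so their squares differ by at most twice `r * δ` in the
      -- direction needed.
      nlinarith [norm_nonneg (inner ℂ φ₀ φ), norm_nonneg (inner ℂ φ₀ (output A))]
    · rw [outputProb, successProb, successOutput_eq_output, output_map,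
        hφ₀.norm_inner_eq hΔ hgap', norm_sq_sub_eq_weightOff]
      have h1 := weightOff_le_add hH.eigenvectorBasis i₀ herr (norm_output_le A)
        (hoff.trans (hrη.trans hη1))
      linarith
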